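/- Let $\mathbb K$ be a field of characteristic zero. Let $(A,P)$ be a complete filtered Rota--Baxter algebra of weight zero over $\mathbb K$: that is, $A$ is an associative $\mathbb K$-algebra, $P:A\to A$ is a $\mathbb K$-linear map with $$P(x)P(y)=P(xP(y))+P(P(x)y)\qquad (x,y\in A),$$ and $A$ carries a decreasing filtration $(A_n)_{n\ge 0}$ by two-sided ideals with $A_mA_n\subseteq A_{m+n}$, $P(A_n)\subseteq A_n$, and $A\cong\varprojlim A/A_n$ via the canonical map. All infinite sums are taken in the topology defined by the filtration. For $u\in A$ write $(\mathrm{ad}\,u)(z)=uz-zu$; for $b\in A_1$ put $\exp(b)=\sum_{n\ge0}b^n/n!$. If $A$ has no unit, the exponentials and the equations in (1) and (2) are read in the algebra $\mathbb K\oplus A$ obtained by adjoining a unit $1$ (in which $A$ is an ideal, so that $P(xa)$ and $P(ay)$ make sense), with the filtration given by the $A_n\subseteq A\subseteq\mathbb K\oplus A$. Then there is exactly one map $\chi_0:A_1\to A_1$ such that for all $a\in A_1$ $$\chi_0(a)=-\frac{\mathrm{ad}\,P(\chi_0(a))}{1-e^{\mathrm{ad}\,P(\chi_0(a))}}(a),$$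 where the right-hand side is the value at $a$ of the formal power series $-X/(1-e^X)=\sum_{n\ge0}\frac{B_n}{n!}X^n$ (with $B_1=-\tfrac12$) in the operator $X=\mathrm{ad}\,P(\chi_0(a))$. Moreover, for every $a\in A_1$: 1. the equation $x=1-P(xa)$ has a unique solution, namely $x=\exp\big(-P(\chi_0(a))\big)$; 2. the equation $y=1+P(ay)$ has a unique solution, namely $y=\exp\big(P(\chi_0(a))\big)$. -/

import Mathlib

open scoped Nat

universe u v

namespace RBMagnus

/-- A Rota--Baxter operator of weight `θ` on a (not necessarily unital) associative algebra. -/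
def IsRotaBaxter {K : Type u} {A : Type v} [Field K] [NonUnitalRing A] [Module K A]
    (θ : K) (P : A →ₗ[K] A) : Prop :=
  ∀ x y : A, P x * P y + θ • P (x * y) = P (x * P y) + P (P x * y)

/-- `F 0 ⊇ F 1 ⊇ ⋯` is a multiplicative filtration of the (not necessarily unital) algebra `A` by
two-sided ideals, and `A` is complete for it. The field `complete` says that the canonical map
from `A` to the inverse limit of the quotients `A / F n` is bijective: a compatible family of
classes is presented by representatives `s n`. -/
structure IsCompleteFiltration {K : Type u} {A : Type v} [Field K] [NonUnitalRing A] [Module K A]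
    (F : ℕ → Submodule K A) : Prop where
  antitone : Antitone F
  mul_mem : ∀ (m n : ℕ) (x y : A), x ∈ F m → y ∈ F n → x * y ∈ F (m + n)
  ideal_left : ∀ (n : ℕ) (x y : A), y ∈ F n → x * y ∈ F n
  ideal_right : ∀ (n : ℕ) (x y : A), x ∈ F n → x * y ∈ F n
  complete : ∀ s : ℕ → A, (∀ m n : ℕ, m ≤ n → s n - s m ∈ F m) →
    ∃! l : A, ∀ n : ℕ, s n - l ∈ F n

/-- A complete filtered Rota--Baxter algebra of weight `θ`: a Rota--Baxter algebra `(A, P)` with a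
complete filtration by Rota--Baxter ideals. -/
structure IsCompleteFilteredRotaBaxter {K : Type u} {A : Type v} [Field K] [NonUnitalRing A]
    [Module K A] (θ : K) (F : ℕ → Submodule K A) (P : A →ₗ[K] A) : Prop where
  rotaBaxter : IsRotaBaxter θ P
  filtration : IsCompleteFiltration F
  map_mem : ∀ (n : ℕ) (x : A), x ∈ F n → P x ∈ F n

/-- `∑ₙ t n = l` in the topology defined by the filtration `F`. -/
def FiltHasSum {K : Type u} {A : Type v} [Field K] [NonUnitalRing A] [Module K A]
    (F : ℕ → Submodule K A) (t : ℕ → A) (l : A) : Prop :=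
  ∀ k : ℕ, ∃ N : ℕ, ∀ n : ℕ, N ≤ n → (∑ i ∈ Finset.range n, t i) - l ∈ F k

/-- `y = exp b = ∑ₙ bⁿ / n!` in the topology defined by the filtration `F`. -/
def IsFiltExp {K : Type u} {A : Type v} [Field K] [Ring A] [Algebra K A]
    (F : ℕ → Submodule K A) (b y : A) : Prop :=
  FiltHasSum F (fun n => ((n ! : K)⁻¹) • b ^ n) y

/-- The operator `ad u : z ↦ u z - z u`. -/
def ad (K : Type u) {A : Type v} [Field K] [NonUnitalRing A] [Module K A]
    [IsScalarTower K A A] [SMulCommClass K A A] (u : A) : Module.End K A :=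
  LinearMap.mulLeft K u - LinearMap.mulRight K u

/-- The formal power series `-X / (1 - exp X) = ∑ₙ (Bₙ / n!) Xⁿ`, with `B₁ = -1/2`. -/
noncomputable def magnusSeries (K : Type u) [Field K] [CharZero K] : PowerSeries K :=
  bernoulliPowerSeries K

/-- The series `magnusSeries` is the quotient `-X / (1 - exp X)` (`K⟦X⟧` is a domain). -/
theorem magnusSeries_mul (K : Type u) [Field K] [CharZero K] :
    magnusSeries K * (1 - PowerSeries.exp K) = -PowerSeries.X := by
  have h := bernoulliPowerSeries_mul_exp_sub_one K
  rw [magnusSeries, ← h]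
  ring

/-- The weight zero recursion `χ(a) = -(ad P(χ(a))) / (1 - exp (ad P(χ(a)))) (a)` for a map
`χ : F 1 → F 1`: the series in the operator `ad P(χ(a))`, applied to `a`, converges to `χ(a)`. -/
def IsZeroBCHRecursion {K : Type u} {A : Type v} [Field K] [CharZero K] [NonUnitalRing A]
    [Module K A] [IsScalarTower K A A] [SMulCommClass K A A]
    (F : ℕ → Submodule K A) (P : A →ₗ[K] A) (χ : F 1 → F 1) : Prop :=
  ∀ a : F 1, FiltHasSum F
    (fun n => PowerSeries.coeff n (magnusSeries K) • ((ad K (P (χ a : A))) ^ n) (a : A))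
    (χ a : A)

/-- The filtration by the `F n ⊆ A ⊆ K ⊕ A` on the algebra `K ⊕ A` obtained by adjoining a unit. -/
def unitizationFiltration {K : Type u} {A : Type v} [Field K] [NonUnitalRing A] [Module K A]
    [IsScalarTower K A A] [SMulCommClass K A A]
    (F : ℕ → Submodule K A) (n : ℕ) : Submodule K (Unitization K A) :=
  (F n).map (Unitization.inrHom K K A)

/-- For `x` in `K ⊕ A` and `a` in the ideal `A`, the product `x a`, as an element of `A`. -/
def unitMul {K : Type u} {A : Type v} [Field K] [NonUnitalRing A] [Module K A]
    (x : Unitization K A) (a : A) : A := (x * (a : Unitization K A)).snd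

/-- For `x` in `K ⊕ A` and `a` in the ideal `A`, the product `a x`, as an element of `A`. -/
def mulUnit {K : Type u} {A : Type v} [Field K] [NonUnitalRing A] [Module K A]
    (a : A) (x : Unitization K A) : A := ((a : Unitization K A) * x).snd

end RBMagnus

/-! Put `c = χ(a)`, `u = P c`, and let `L`, `R` be left and right multiplication by `u`, so that `D
= ad u = L - R`. In weight zero, induction gives `u ^ (n + 1) = P (∑_{i+j=n} L^i R^j c)`
(`pow_eq_apply_sum_antidiagonal`). Dividing by `(n + 1)!` and summing, `exp u - 1 = P ((e^L - e^R) /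
(L - R) c) = P (e^R ((e^D - 1) / D) c)`. The recursion says `c = D / (e^D - 1) a`, so the right side
is `P (e^R a) = P (a * exp u)`. The other equation is the same computation for `-c`, `-a` with `L`
and `R` exchanged, which leaves the difference operator equal to `ad u`. `IsFiltExp.eq_one_add`
covers both.

The recursion is a fixed point problem for a contraction of `F 1`. Each linear equation has only one
solution, because the difference of two solutions climbs through every `F n`. All series are handled
as finite sums modulo `F N`. The non-unital case is the same argument in `K ⊕ A`, so the Rota–Baxter
identity is assumed only on `F 1`, and `1 ∈ F 0` is never used. -/

namespace RBMagnus

open Finset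

/-! ### Truncated power series in operators that raise the filtration degree. -/

section Operators

/-- The geometric sum in two commuting variables, expanded in powers of their difference. -/
theorem sum_antidiagonal_pow_mul_pow {R : Type*} [Ring R] {S T : R} (h : Commute S T) (n : ℕ) :
    ∑ p ∈ antidiagonal n, S ^ p.1 * T ^ p.2 =
      ∑ p ∈ antidiagonal n, (n + 1).choose (p.1 + 1) • ((S - T) ^ p.1 * T ^ p.2) := by
  have hD : Commute (S - T) T := h.sub_left (Commute.refl T)
  induction n with
  | zero => simp
  | succ n ih =>
    -- Binomial theorem for `S = (S - T) + T`; Pascal's rule then merges this term with the degree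
    -- `n` identity.
    have hS : S ^ (n + 1) = ∑ p ∈ antidiagonal (n + 1),
        (n + 1).choose p.1 • ((S - T) ^ p.1 * T ^ p.2) := by
      rw [← hD.add_pow', sub_add_cancel]
    have hR : ∑ p ∈ antidiagonal (n + 1),
        (n + 1).choose (p.1 + 1) • ((S - T) ^ p.1 * T ^ p.2) =
        (∑ p ∈ antidiagonal n, (n + 1).choose (p.1 + 1) • ((S - T) ^ p.1 * T ^ p.2)) * T := by
      rw [Nat.sum_antidiagonal_succ', sum_mul]
      simp [pow_succ, mul_assoc]
    have hL : ∑ p ∈ antidiagonal (n + 1), S ^ p.1 * T ^ p.2 =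
        (∑ p ∈ antidiagonal n, S ^ p.1 * T ^ p.2) * T + S ^ (n + 1) := by
      rw [Nat.sum_antidiagonal_succ', sum_mul, add_comm]
      simp [pow_succ, mul_assoc]
    rw [hL, ih, ← hR, hS, ← sum_add_distrib]
    refine sum_congr rfl fun p _ => ?_
    rw [← add_smul, Nat.choose_succ_succ (n + 1) p.1, add_comm]

/-- A square sum and the corresponding triangular sum agree modulo a submodule containing the
terms above the diagonal. -/
theorem sum_range_sum_range_sub_sum_antidiagonal_mem {K V : Type*} [Ring K] [AddCommGroup V]
    [Module K V] (M : Submodule K V) (N : ℕ) (f : ℕ → ℕ → V)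
    (hf : ∀ k l, N ≤ k + l → f k l ∈ M) :
    ∑ k ∈ range N, ∑ l ∈ range N, f k l - ∑ n ∈ range N, ∑ p ∈ antidiagonal n, f p.1 p.2 ∈ M := by
  have h1 : ∑ n ∈ range N, ∑ p ∈ antidiagonal n, f p.1 p.2 =
      ∑ p ∈ (range N ×ˢ range N) with p.1 + p.2 < N, f p.1 p.2 := by
    rw [sum_sigma']
    refine sum_bij' (fun x _ => x.2) (fun p _ => ⟨p.1 + p.2, p⟩) ?_ ?_ ?_ ?_ ?_
    · rintro ⟨n, k, l⟩ h
      simp only [mem_sigma, mem_range, HasAntidiagonal.mem_antidiagonal, mem_filter,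
        mem_product] at h ⊢
      omega
    · rintro ⟨k, l⟩ h
      simp only [mem_sigma, mem_range, HasAntidiagonal.mem_antidiagonal, mem_filter] at h ⊢
      exact ⟨h.2, trivial⟩
    · rintro ⟨n, k, l⟩ h
      simp only [mem_sigma, mem_range, HasAntidiagonal.mem_antidiagonal] at h
      obtain ⟨_, rfl⟩ := h
      rfl
    · intros; rfl
    · intros; rfl
  rw [h1, ← sum_product', ← sum_filter_add_sum_filter_not (range N ×ˢ range N)
    (fun p => p.1 + p.2 < N), add_sub_cancel_left]
  refine M.sum_mem fun p hp => hf _ _ ?_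
  simpa using (mem_filter.1 hp).2

/-- The operator raises the filtration degree. -/
def Raises {K V : Type*} [Field K] [AddCommGroup V] [Module K V] (F : ℕ → Submodule K V)
    (S : Module.End K V) : Prop :=
  ∀ k x, x ∈ F k → S x ∈ F (k + 1)

variable {K V : Type*} [Field K] [AddCommGroup V] [Module K V] {F : ℕ → Submodule K V}

theorem Raises.pow {S : Module.End K V} (hS : Raises F S) (n : ℕ) {k : ℕ} {x : V}
    (hx : x ∈ F k) : (S ^ n) x ∈ F (k + n) := by
  induction n with
  | zero => simpa using hx
  | succ n ih =>
    rw [pow_succ', Module.End.mul_apply, ← add_assoc]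
    exact hS _ _ ih

/-- The power series `(exp X - 1) / X`. -/
noncomputable def expQuotient (K : Type*) [Field K] : PowerSeries K :=
  PowerSeries.mk fun n => (((n + 1) ! : ℕ) : K)⁻¹

theorem expQuotient_mul_magnusSeries (K : Type*) [Field K] [CharZero K] :
    expQuotient K * magnusSeries K = 1 := by
  have h : PowerSeries.X * expQuotient K = PowerSeries.exp K - 1 := by
    ext n
    cases n with
    | zero => simp
    | succ n =>
      simp [expQuotient, PowerSeries.coeff_succ_X_mul, PowerSeries.coeff_exp,
        PowerSeries.coeff_one]
  have h2 := magnusSeries_mul K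
  refine mul_left_cancel₀ (PowerSeries.X_ne_zero (R := K)) ?_
  rw [← mul_assoc, h]
  linear_combination -h2

variable [CharZero K]

/-- Inverts the recursion: `c = D / (e^D - 1) a` gives `a = (e^D - 1) / D c`. The Cauchy product of
the two series is `1`, and its terms of degree at least `N` fall into `F N`. -/
theorem sum_expQuotient_sub_mem {D : Module.End K V} (hF : Antitone F) (hD : Raises F D) (N : ℕ)
    {a c : V} (ha : a ∈ F 0)
    (hc : ∑ n ∈ range N, PowerSeries.coeff n (magnusSeries K) • (D ^ n) a - c ∈ F N) :
    ∑ k ∈ range N, PowerSeries.coeff k (expQuotient K) • (D ^ k) c - a ∈ F N := by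
  have h1 := sum_range_sum_range_sub_sum_antidiagonal_mem (F N) N
    (fun k l => (PowerSeries.coeff k (expQuotient K) * PowerSeries.coeff l (magnusSeries K)) •
      (D ^ (k + l)) a) (fun k l hkl => (F N).smul_mem _ (hF hkl (by simpa using hD.pow (k + l) ha)))
  have h2 : ∑ n ∈ range N, ∑ p ∈ antidiagonal n,
      (PowerSeries.coeff p.1 (expQuotient K) * PowerSeries.coeff p.2 (magnusSeries K)) •
      (D ^ (p.1 + p.2)) a = ∑ n ∈ range N, if n = 0 then a else 0 := by
    refine sum_congr rfl fun n _ => ?_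
    have h3 : ∑ p ∈ antidiagonal n,
        (PowerSeries.coeff p.1 (expQuotient K) * PowerSeries.coeff p.2 (magnusSeries K)) •
        (D ^ (p.1 + p.2)) a = (PowerSeries.coeff n (expQuotient K * magnusSeries K)) •
        (D ^ n) a := by
      rw [PowerSeries.coeff_mul, sum_smul]
      exact sum_congr rfl fun p hp => by rw [HasAntidiagonal.mem_antidiagonal.1 hp]
    rw [h3, expQuotient_mul_magnusSeries, PowerSeries.coeff_one]
    split_ifs with h <;> simp [h]
  have h4 : (∑ n ∈ range N, if n = 0 then a else 0) - a ∈ F N := by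
    cases N with
    | zero => simpa using ha
    | succ N => simp
  have h5 : ∑ k ∈ range N, PowerSeries.coeff k (expQuotient K) • (D ^ k)
      (∑ n ∈ range N, PowerSeries.coeff n (magnusSeries K) • (D ^ n) a - c) ∈ F N :=
    (F N).sum_mem fun k _ => (F N).smul_mem _ (hF (Nat.le_add_right N k) (hD.pow k hc))
  have h6 : ∑ k ∈ range N, PowerSeries.coeff k (expQuotient K) • (D ^ k)
      (∑ n ∈ range N, PowerSeries.coeff n (magnusSeries K) • (D ^ n) a - c) =
      ∑ k ∈ range N, ∑ l ∈ range N,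
      (PowerSeries.coeff k (expQuotient K) * PowerSeries.coeff l (magnusSeries K)) •
      (D ^ (k + l)) a - ∑ k ∈ range N, PowerSeries.coeff k (expQuotient K) • (D ^ k) c := by
    rw [← sum_sub_distrib]
    refine sum_congr rfl fun k _ => ?_
    rw [map_sub, smul_sub, map_sum, smul_sum]
    congr 1
    refine sum_congr rfl fun l _ => ?_
    rw [map_smul, smul_smul, pow_add, Module.End.mul_apply]
  rw [h6] at h5
  rw [h2] at h1
  have := (F N).add_mem ((F N).sub_mem h1 h5) h4
  convert this using 1
  abel

/-- Modulo `F N`, the derivative of the exponential: if `c` is the value at `a` of the series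
`D / (exp D - 1)` with `D = S - T`, then `(exp S - exp T) / D` sends `c` to `exp T` of `a`. -/
theorem sum_antidiagonal_sub_sum_exp_mem {S T : Module.End K V} (hF : Antitone F)
    (hST : Commute S T) (hS : Raises F S) (hT : Raises F T) (N : ℕ) {a c : V} (ha : a ∈ F 0)
    (hc0 : c ∈ F 0)
    (hc : ∑ n ∈ range N, PowerSeries.coeff n (magnusSeries K) • ((S - T) ^ n) a - c ∈ F N) :
    ∑ n ∈ range N, (((n + 1) ! : ℕ) : K)⁻¹ • ∑ p ∈ antidiagonal n, (S ^ p.1) ((T ^ p.2) c) -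
      ∑ l ∈ range N, ((l ! : ℕ) : K)⁻¹ • (T ^ l) a ∈ F N := by
  have hD : Raises F (S - T) := fun k x hx => by
    rw [LinearMap.sub_apply]
    exact (F (k + 1)).sub_mem (hS k x hx) (hT k x hx)
  have hDT : Commute (S - T) T := hST.sub_left (Commute.refl T)
  have h1 := sum_range_sum_range_sub_sum_antidiagonal_mem (F N) N
    (fun k l => (((k + 1) ! : ℕ) : K)⁻¹ • ((l ! : ℕ) : K)⁻¹ • ((S - T) ^ k) ((T ^ l) c))
    (fun k l hkl => (F N).smul_mem _ ((F N).smul_mem _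
      (hF (by omega : N ≤ 0 + l + k) (hD.pow k (hT.pow l hc0)))))
  -- The degree `n` part of `(e^S - e^T) / (S - T) = e^T (e^D - 1) / D`: for `k + l = n`, the factor
  -- `(n+1).choose (k+1) / (n+1)!` is `1 / ((k+1)! l!)`.
  have h2 : ∀ n, (((n + 1) ! : ℕ) : K)⁻¹ • ∑ p ∈ antidiagonal n, (S ^ p.1) ((T ^ p.2) c) =
      ∑ p ∈ antidiagonal n, (((p.1 + 1) ! : ℕ) : K)⁻¹ • ((p.2 ! : ℕ) : K)⁻¹ •
        ((S - T) ^ p.1) ((T ^ p.2) c) := by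
    intro n
    have h3 := congrArg (fun f : Module.End K V => f c) (sum_antidiagonal_pow_mul_pow hST n)
    simp only [LinearMap.sum_apply, Module.End.mul_apply, LinearMap.smul_apply] at h3
    rw [h3, smul_sum]
    refine sum_congr rfl fun p hp => ?_
    rw [← Nat.cast_smul_eq_nsmul K, smul_smul, smul_smul]
    congr 1
    have h4 : p.2 = n + 1 - (p.1 + 1) := by have := HasAntidiagonal.mem_antidiagonal.1 hp; omega
    have h5 : p.1 + 1 ≤ n + 1 := by have := HasAntidiagonal.mem_antidiagonal.1 hp; omega
    have h6 := Nat.choose_mul_factorial_mul_factorial h5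
    rw [← h4] at h6
    have h7 : (((n + 1) ! : ℕ) : K) ≠ 0 := Nat.cast_ne_zero.2 (Nat.factorial_ne_zero _)
    have h8 : (((p.1 + 1) ! : ℕ) : K) ≠ 0 := Nat.cast_ne_zero.2 (Nat.factorial_ne_zero _)
    have h9 : ((p.2 ! : ℕ) : K) ≠ 0 := Nat.cast_ne_zero.2 (Nat.factorial_ne_zero _)
    have h10 : (((n + 1).choose (p.1 + 1) : ℕ) : K) * ((p.1 + 1) ! : ℕ) * (p.2 ! : ℕ) =
        ((n + 1) ! : ℕ) := by exact_mod_cast h6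
    field_simp
    linear_combination h10
  simp only [h2]
  have h3 : ∑ l ∈ range N, ((l ! : ℕ) : K)⁻¹ • (T ^ l)
      (∑ k ∈ range N, PowerSeries.coeff k (expQuotient K) • ((S - T) ^ k) c - a) ∈ F N :=
    (F N).sum_mem fun l _ => (F N).smul_mem _ (hF (Nat.le_add_right N l)
      (hT.pow l (sum_expQuotient_sub_mem hF hD N ha hc)))
  have h4 : ∑ l ∈ range N, ((l ! : ℕ) : K)⁻¹ • (T ^ l)
      (∑ k ∈ range N, PowerSeries.coeff k (expQuotient K) • ((S - T) ^ k) c - a) =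
      ∑ k ∈ range N, ∑ l ∈ range N, (((k + 1) ! : ℕ) : K)⁻¹ • ((l ! : ℕ) : K)⁻¹ •
        ((S - T) ^ k) ((T ^ l) c) - ∑ l ∈ range N, ((l ! : ℕ) : K)⁻¹ • (T ^ l) a := by
    rw [sum_comm, ← sum_sub_distrib]
    refine sum_congr rfl fun l _ => ?_
    rw [map_sub, smul_sub, map_sum, smul_sum]
    congr 1
    refine sum_congr rfl fun k _ => ?_
    rw [map_smul, smul_comm, ← Module.End.mul_apply, ← Module.End.mul_apply,
      (hDT.pow_pow k l).eq, expQuotient, PowerSeries.coeff_mk]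
  rw [h4] at h3
  convert (F N).sub_mem h3 h1 using 1
  abel

end Operators

/-! ### Completeness, fixed points and exponentials. -/

section Filtration

variable {K A : Type*} [Field K] [Ring A] [Algebra K A] {F : ℕ → Submodule K A}

theorem IsCompleteFiltration.eq_of_sub_mem (hF : IsCompleteFiltration F) {x y : A}
    (h : ∀ n, x - y ∈ F n) : x = y := by
  obtain ⟨l, _, hl⟩ := hF.complete (fun _ => x) (fun m n _ => by simp)
  rw [hl x (fun n => by simp), hl y h]

theorem IsCompleteFiltration.exists_sum (hF : IsCompleteFiltration F) {t : ℕ → A}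
    (ht : ∀ n, t n ∈ F n) : ∃ l, FiltHasSum F t l := by
  obtain ⟨l, hl, _⟩ := hF.complete (fun n => ∑ i ∈ range n, t i) (fun m n hmn => by
    rw [← sum_Ico_eq_sub _ hmn]
    exact (F m).sum_mem fun i hi => hF.antitone (mem_Ico.1 hi).1 (ht i))
  exact ⟨l, fun k => ⟨k, fun n hn => hF.antitone hn (hl n)⟩⟩

theorem FiltHasSum.sum_range_sub_mem {t : ℕ → A} {l : A}
    (h : FiltHasSum F t l) {k : ℕ} (ht : ∀ n, k ≤ n → t n ∈ F k) :
    ∑ i ∈ range k, t i - l ∈ F k := by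
  obtain ⟨N, hN⟩ := h k
  have h1 := hN (max N k) (le_max_left _ _)
  have h2 : ∑ i ∈ range (max N k), t i - ∑ i ∈ range k, t i ∈ F k := by
    rw [← sum_Ico_eq_sub _ (le_max_right _ _)]
    exact (F k).sum_mem fun i hi => ht i (mem_Ico.1 hi).1
  convert (F k).sub_mem h1 h2 using 1
  abel

/-- The fixed point theorem for contractions of `F 1`. -/
theorem IsCompleteFiltration.existsUnique_fixedPoint (hF : IsCompleteFiltration F) (Φ : A → A)
    (h1 : ∀ c ∈ F 1, Φ c ∈ F 1)
    (h2 : ∀ k, ∀ c ∈ F 1, ∀ d ∈ F 1, c - d ∈ F k → Φ c - Φ d ∈ F (k + 1)) :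
    ∃! c, c ∈ F 1 ∧ Φ c = c := by
  set s : ℕ → A := fun n => Φ^[n] 0 with hs
  have hss : ∀ n, s (n + 1) = Φ (s n) := fun n => Function.iterate_succ_apply' Φ n 0
  have hs1 : ∀ n, s n ∈ F 1 := by
    intro n
    induction n with
    | zero => simp [hs]
    | succ n ih => rw [hss]; exact h1 _ ih
  have hst : ∀ n, s (n + 1) - s n ∈ F n := by
    intro n
    induction n with
    | zero => exact hF.antitone zero_le_one ((F 1).sub_mem (hs1 _) (hs1 _))
    | succ n ih =>
      rw [hss (n + 1), hss n]
      exact h2 _ _ (h1 _ (hs1 n)) _ (hs1 n) (by rwa [← hss n])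
  obtain ⟨l, hl, _⟩ := hF.complete s (fun m n hmn => by
    induction n, hmn using Nat.le_induction with
    | base => simp
    | succ n hmn ih =>
      rw [← sub_add_sub_cancel _ (s n)]
      exact (F m).add_mem (hF.antitone hmn (hst n)) ih)
  have hl1 : l ∈ F 1 := by
    have := (F 1).sub_mem (hs1 1) (hl 1)
    rwa [sub_sub_cancel] at this
  have hΦl : Φ l = l := hF.eq_of_sub_mem fun n => by
    have h3 := h2 n _ (hs1 n) _ hl1 (hl n)
    rw [← hss] at h3
    have h4 := (F (n + 1)).sub_mem (hl (n + 1)) h3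
    rw [sub_sub_sub_cancel_left] at h4
    exact hF.antitone (Nat.le_succ n) h4
  refine ⟨l, ⟨hl1, hΦl⟩, ?_⟩
  rintro c ⟨hc, hΦ⟩
  refine hF.eq_of_sub_mem fun n => ?_
  induction n with
  | zero => exact hF.antitone zero_le_one ((F 1).sub_mem hc hl1)
  | succ n ih =>
    have := h2 n _ hc _ hl1 ih
    rwa [hΦ, hΦl] at this

theorem IsCompleteFiltration.mulLeft_raises (hF : IsCompleteFiltration F) {u : A}
    (hu : u ∈ F 1) : Raises F (LinearMap.mulLeft K u) := fun k x hx => by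
  rw [add_comm]
  exact hF.mul_mem 1 k u x hu hx

theorem IsCompleteFiltration.mulRight_raises (hF : IsCompleteFiltration F) {u : A}
    (hu : u ∈ F 1) : Raises F (LinearMap.mulRight K u) := fun k x hx =>
  hF.mul_mem k 1 x u hx hu

theorem IsCompleteFiltration.ad_mem (hF : IsCompleteFiltration F) {u x : A} {k m : ℕ}
    (hu : u ∈ F m) (hx : x ∈ F k) : ad K u x ∈ F (k + m) := by
  have h : u * x ∈ F (k + m) := by rw [add_comm]; exact hF.mul_mem m k u x hu hx
  exact (F (k + m)).sub_mem h (hF.mul_mem k m x u hx hu)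

theorem IsCompleteFiltration.pow_mem (hF : IsCompleteFiltration F) {u : A} (hu : u ∈ F 1)
    (n : ℕ) : u ^ (n + 1) ∈ F (n + 1) := by
  have := (hF.mulLeft_raises hu).pow n hu
  rwa [LinearMap.pow_mulLeft, LinearMap.mulLeft_apply, ← pow_succ, add_comm] at this

/-- The constant term is split off because `F 0` need not contain `1`. -/
theorem IsCompleteFiltration.exists_exp (hF : IsCompleteFiltration F) {u : A} (hu : u ∈ F 1) :
    ∃ y, IsFiltExp F u y := by
  obtain ⟨l, hl⟩ := hF.exists_sum (t := fun n => (((n + 1) ! : ℕ) : K)⁻¹ • u ^ (n + 1))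
    (fun n => (F n).smul_mem _ (hF.antitone (Nat.le_succ n) (hF.pow_mem hu n)))
  refine ⟨1 + l, fun k => ?_⟩
  obtain ⟨N, hN⟩ := hl k
  refine ⟨N + 1, fun n hn => ?_⟩
  obtain ⟨m, rfl⟩ : ∃ m, n = m + 1 := ⟨n - 1, by omega⟩
  rw [sum_range_succ']
  convert hN m (by omega) using 1
  simp
  abel

/-- At least one term must be kept: the empty sum would require `y ∈ F 0`, which can fail in `K ⊕
A`. -/
theorem IsFiltExp.sum_range_sub_mem (hF : IsCompleteFiltration F) {u y : A} (hu : u ∈ F 1)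
    (hy : IsFiltExp F u y) (N : ℕ) :
    ∑ n ∈ range (N + 1), ((n ! : ℕ) : K)⁻¹ • u ^ n - y ∈ F (N + 1) :=
  FiltHasSum.sum_range_sub_mem hy fun n hn => by
    obtain ⟨m, rfl⟩ : ∃ m, n = m + 1 := ⟨n - 1, by omega⟩
    exact (F (N + 1)).smul_mem _ (hF.antitone hn (hF.pow_mem hu m))

theorem eq_zero_of_mem_step (hF : IsCompleteFiltration F) {x : A} (h0 : x ∈ F 0)
    (h : ∀ n, x ∈ F n → x ∈ F (n + 1)) : x = 0 :=
  hF.eq_of_sub_mem fun n => by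
    rw [sub_zero]
    induction n with
    | zero => exact h0
    | succ n ih => exact h n ih

/-! ### The Rota–Baxter operator, the recursion and the two equations. -/

variable {P : A →ₗ[K] A}

/-- Writing `s_n` for the inner sum, `P s_n * P d = P (s_n * P d) + P (P d ^ (n + 1) * d)`, and the
two arguments add up to `s_{n+1} = R s_n + L^(n+1) d`. -/
theorem pow_eq_apply_sum_antidiagonal (hF : IsCompleteFiltration F)
    (hP : ∀ n x, x ∈ F n → P x ∈ F n)
    (hRB : ∀ x ∈ F 1, ∀ y ∈ F 1, P x * P y = P (x * P y) + P (P x * y)) {d : A} (hd : d ∈ F 1)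
    (n : ℕ) : P d ^ (n + 1) = P (∑ p ∈ antidiagonal n,
      (LinearMap.mulLeft K (P d) ^ p.1) ((LinearMap.mulRight K (P d) ^ p.2) d)) := by
  have hmem : ∀ n, ∑ p ∈ antidiagonal n,
      (LinearMap.mulLeft K (P d) ^ p.1) ((LinearMap.mulRight K (P d) ^ p.2) d) ∈ F 1 := fun n =>
    (F 1).sum_mem fun p _ => hF.antitone (by omega)
      ((hF.mulLeft_raises (hP 1 d hd)).pow p.1 ((hF.mulRight_raises (hP 1 d hd)).pow p.2 hd))
  induction n with
  | zero => simp
  | succ n ih =>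
    rw [pow_succ, ih, hRB _ (hmem n) _ hd, ← ih, ← map_add, Nat.sum_antidiagonal_succ', add_comm,
      sum_mul]
    simp only [LinearMap.pow_mulLeft, LinearMap.pow_mulRight, LinearMap.mulLeft_apply,
      LinearMap.mulRight_apply]
    simp only [pow_zero, mul_one, pow_succ, mul_assoc]

variable [CharZero K]

/-- The recursion has exactly one solution in `F 1`. -/
theorem IsCompleteFiltration.existsUnique_magnus (hF : IsCompleteFiltration F)
    (hP : ∀ n x, x ∈ F n → P x ∈ F n) {a : A} (ha : a ∈ F 1) :
    ∃! c, c ∈ F 1 ∧ FiltHasSum F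
      (fun n => PowerSeries.coeff n (magnusSeries K) • ((ad K (P c)) ^ n) a) c := by
  have hr : ∀ c ∈ F 1, Raises F (ad K (P c)) := fun c hc k x hx => hF.ad_mem (hP 1 c hc) hx
  have ht : ∀ c ∈ F 1, ∀ n, PowerSeries.coeff n (magnusSeries K) • ((ad K (P c)) ^ n) a ∈
      F (1 + n) := fun c hc n => (F (1 + n)).smul_mem _ ((hr c hc).pow n ha)
  -- The map `Φ` is total on `A`; its value outside `F 1` is a default.
  have hex : ∀ c, ∃ l, c ∈ F 1 → FiltHasSum F
      (fun n => PowerSeries.coeff n (magnusSeries K) • ((ad K (P c)) ^ n) a) l := by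
    intro c
    by_cases hc : c ∈ F 1
    · obtain ⟨l, hl⟩ := hF.exists_sum (t := fun n => PowerSeries.coeff n (magnusSeries K) •
        ((ad K (P c)) ^ n) a) (fun n => hF.antitone (Nat.le_add_left n 1) (ht c hc n))
      exact ⟨l, fun _ => hl⟩
    · exact ⟨0, fun h => absurd h hc⟩
  choose Φ hΦ using hex
  have hrem : ∀ c ∈ F 1, ∀ k, ∑ n ∈ range k, PowerSeries.coeff n (magnusSeries K) •
      ((ad K (P c)) ^ n) a - Φ c ∈ F k := fun c hc k =>
    FiltHasSum.sum_range_sub_mem (hΦ c hc) fun n hn =>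
      hF.antitone (by omega) (ht c hc n)
  obtain ⟨c, ⟨hc1, hc2⟩, huniq⟩ := hF.existsUnique_fixedPoint Φ
    (fun c hc => by
      have h1 : ∑ n ∈ range 1, PowerSeries.coeff n (magnusSeries K) •
        ((ad K (P c)) ^ n) a ∈ F 1 := (F 1).sum_mem fun n _ =>
          hF.antitone (Nat.le_add_right 1 n) (ht c hc n)
      have h2 := (F 1).sub_mem h1 (hrem c hc 1)
      rwa [sub_sub_cancel] at h2)
    (fun k c hc d hd hcd => by
      have hpow : ∀ n, ((ad K (P c)) ^ n) a - ((ad K (P d)) ^ n) a ∈ F (k + 1) := by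
        intro n
        induction n with
        | zero => simp
        | succ n ih =>
          have h1 : ((ad K (P c)) ^ (n + 1)) a - ((ad K (P d)) ^ (n + 1)) a =
              ad K (P c) (((ad K (P c)) ^ n) a - ((ad K (P d)) ^ n) a) +
              ad K (P (c - d)) (((ad K (P d)) ^ n) a) := by
            rw [pow_succ', pow_succ', Module.End.mul_apply, Module.End.mul_apply, map_sub]
            simp only [ad, map_sub, LinearMap.sub_apply, LinearMap.mulLeft_apply,
              LinearMap.mulRight_apply, sub_mul, mul_sub]
            abel
          rw [h1]
          refine (F (k + 1)).add_mem (hF.antitone (Nat.le_succ _) (hr c hc _ _ ih)) ?_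
          -- The contraction gains its degree here: `P (c - d) ∈ F k` meets an element of `F (1 +
          -- n)`, because `a ∈ F 1`.
          exact hF.antitone (by omega) (hF.ad_mem (hP k _ hcd) ((hr d hd).pow n ha))
      have h2 : ∑ n ∈ range (k + 1), PowerSeries.coeff n (magnusSeries K) •
          ((ad K (P c)) ^ n) a - ∑ n ∈ range (k + 1), PowerSeries.coeff n (magnusSeries K) •
          ((ad K (P d)) ^ n) a ∈ F (k + 1) := by
        rw [← sum_sub_distrib]
        refine (F (k + 1)).sum_mem fun n _ => ?_
        rw [← smul_sub]
        exact (F (k + 1)).smul_mem _ (hpow n)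
      convert (F (k + 1)).add_mem ((F (k + 1)).sub_mem h2 (hrem c hc (k + 1)))
        (hrem d hd (k + 1)) using 1
      abel)
  refine ⟨c, ⟨hc1, by simpa only [hc2] using hΦ c hc1⟩, ?_⟩
  rintro d ⟨hd1, hd2⟩
  refine huniq d ⟨hd1, hF.eq_of_sub_mem fun n => ?_⟩
  have h1 := FiltHasSum.sum_range_sub_mem hd2 (k := n) fun m hm =>
    hF.antitone (by omega) (ht d hd1 m)
  have h2 := (F n).sub_mem h1 (hrem d hd1 n)
  rwa [sub_sub_sub_cancel_left] at h2

/-- If the operators `S`, `T` are the left and right multiplications by `P d`, in either order, and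
`d` is the value at `b` of `(S - T) / (exp (S - T) - 1)`, then the exponential `y` of `P d`
satisfies `y = 1 + P (exp T b)`. -/
theorem IsFiltExp.eq_one_add (hF : IsCompleteFiltration F)
    (hP : ∀ n x, x ∈ F n → P x ∈ F n)
    (hRB : ∀ x ∈ F 1, ∀ y ∈ F 1, P x * P y = P (x * P y) + P (P x * y)) {b d y z : A}
    (hb : b ∈ F 1) (hd : d ∈ F 1) (hy : IsFiltExp F (P d) y) {S T : Module.End K A}
    (hS : Raises F S) (hT : Raises F T) (hST : Commute S T)
    (hsum : ∀ n, ∑ p ∈ antidiagonal n, (S ^ p.1) ((T ^ p.2) d) = ∑ p ∈ antidiagonal n,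
      (LinearMap.mulLeft K (P d) ^ p.1) ((LinearMap.mulRight K (P d) ^ p.2) d))
    (hbd : FiltHasSum F (fun n => PowerSeries.coeff n (magnusSeries K) • ((S - T) ^ n) b) d)
    (hz : ∀ N, ∑ l ∈ range N, ((l ! : ℕ) : K)⁻¹ • (T ^ l) b - z ∈ F N) :
    y = 1 + P z := by
  have h01 : F 1 ≤ F 0 := hF.antitone zero_le_one
  have hD : Raises F (S - T) := fun k x hx => by
    rw [LinearMap.sub_apply]
    exact (F (k + 1)).sub_mem (hS k x hx) (hT k x hx)
  refine hF.eq_of_sub_mem fun N => ?_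
  have h1 := FiltHasSum.sum_range_sub_mem hbd (k := N) fun n hn =>
    (F N).smul_mem _ (hF.antitone (by omega) (hD.pow n hb))
  have h2 := hP _ _ (sum_antidiagonal_sub_sum_exp_mem hF.antitone hST hS hT N (h01 hb) (h01 hd) h1)
  have h3 := hP _ _ (hz N)
  have h4 := hF.antitone (Nat.le_succ N) (hy.sum_range_sub_mem hF (hP 1 d hd) N)
  -- The degree zero term gives `1`; the remaining `N` terms match the sum in `h2`.
  have h5 : ∑ n ∈ range (N + 1), ((n ! : ℕ) : K)⁻¹ • P d ^ n = 1 + P (∑ n ∈ range N,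
      (((n + 1) ! : ℕ) : K)⁻¹ • ∑ p ∈ antidiagonal n, (S ^ p.1) ((T ^ p.2) d)) := by
    rw [sum_range_succ', map_sum, add_comm]
    congr 1
    · simp
    · refine sum_congr rfl fun n _ => ?_
      rw [map_smul, hsum, pow_eq_apply_sum_antidiagonal hF hP hRB hd n]
  rw [h5] at h4
  rw [map_sub] at h2 h3
  convert (F N).sub_mem ((F N).add_mem h2 h3) h4 using 1
  abel

theorem exists_exp_eq_one_add (hF : IsCompleteFiltration F)
    (hP : ∀ n x, x ∈ F n → P x ∈ F n)
    (hRB : ∀ x ∈ F 1, ∀ y ∈ F 1, P x * P y = P (x * P y) + P (P x * y)) {a c : A}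
    (ha : a ∈ F 1) (hc : c ∈ F 1) (hac : FiltHasSum F
      (fun n => PowerSeries.coeff n (magnusSeries K) • ((ad K (P c)) ^ n) a) c) :
    ∃ y, IsFiltExp F (P c) y ∧ y = 1 + P (a * y) ∧ ∀ z, z = 1 + P (a * z) → z = y := by
  have hu := hP 1 c hc
  obtain ⟨y, hy⟩ := hF.exists_exp hu
  have hy1 : y = 1 + P (a * y) :=
    hy.eq_one_add hF hP hRB ha hc (hF.mulLeft_raises hu) (hF.mulRight_raises hu)
      (LinearMap.commute_mulLeft_right _ _) (fun n => rfl) hac fun N => by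
      have h := hF.mul_mem 1 _ a _ ha (hy.sum_range_sub_mem hF hu N)
      have h1 := (hF.mulRight_raises hu).pow N ha
      rw [mul_sub, mul_sum, sum_range_succ] at h
      have h2 : ∑ l ∈ range N, ((l ! : ℕ) : K)⁻¹ • ((LinearMap.mulRight K (P c)) ^ l) a =
          ∑ l ∈ range N, a * ((l ! : ℕ) : K)⁻¹ • P c ^ l := by
        refine sum_congr rfl fun l _ => ?_
        rw [LinearMap.pow_mulRight, LinearMap.mulRight_apply, mul_smul_comm]
      rw [LinearMap.pow_mulRight, LinearMap.mulRight_apply] at h1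
      rw [h2]
      -- The estimate `h` concerns `N + 1` terms; the last is dropped since `a * P c ^ N` lies in `F
      -- (1 + N)`.
      have h3 := (F N).sub_mem (hF.antitone (by omega : N ≤ 1 + (N + 1)) h)
        ((F N).smul_mem ((N ! : ℕ) : K)⁻¹ (hF.antitone (by omega : N ≤ 1 + N) h1))
      convert h3 using 1
      rw [mul_smul_comm]
      abel
  refine ⟨y, hy, hy1, fun z hz => sub_eq_zero.1 ?_⟩
  have h1 : z - y = P (a * (z - y)) := by
    rw [mul_sub, map_sub]
    nth_rewrite 1 [hz, hy1]
    abel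
  refine eq_zero_of_mem_step hF ?_ fun n hn => ?_
  · rw [h1]
    exact hF.antitone zero_le_one (hP 1 _ (hF.ideal_right 1 _ _ ha))
  · rw [h1]
    exact hP _ _ (by rw [add_comm]; exact hF.mul_mem 1 n _ _ ha hn)

theorem exists_exp_eq_one_sub (hF : IsCompleteFiltration F)
    (hP : ∀ n x, x ∈ F n → P x ∈ F n)
    (hRB : ∀ x ∈ F 1, ∀ y ∈ F 1, P x * P y = P (x * P y) + P (P x * y)) {a c : A}
    (ha : a ∈ F 1) (hc : c ∈ F 1) (hac : FiltHasSum F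
      (fun n => PowerSeries.coeff n (magnusSeries K) • ((ad K (P c)) ^ n) a) c) :
    ∃ x, IsFiltExp F (-P c) x ∧ x = 1 - P (x * a) ∧ ∀ z, z = 1 - P (z * a) → z = x := by
  have hc' := (F 1).neg_mem hc
  have ha' := (F 1).neg_mem ha
  have hu := hP 1 _ hc'
  obtain ⟨x, hx⟩ := hF.exists_exp hu
  have hcomm := LinearMap.commute_mulLeft_right (R := K) (P (-c)) (P (-c))
  -- The sign change of `c` and the exchange of sides cancel, so the recursion for `a`, `c` serves
  -- `-a`, `-c`.
  have hD : LinearMap.mulRight K (P (-c)) - LinearMap.mulLeft K (P (-c)) = ad K (P c) := by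
    ext z
    simp only [ad, map_neg, LinearMap.sub_apply, LinearMap.mulLeft_apply,
      LinearMap.mulRight_apply, neg_mul, mul_neg]
    abel
  have hx1 : x = 1 + P (x * -a) :=
    hx.eq_one_add hF hP hRB ha' hc' (hF.mulRight_raises hu) (hF.mulLeft_raises hu)
      hcomm.symm (fun n => by
        rw [← Nat.sum_antidiagonal_swap]
        refine sum_congr rfl fun p _ => ?_
        rw [← Module.End.mul_apply, ← Module.End.mul_apply, Prod.fst_swap, Prod.snd_swap,
          (hcomm.pow_pow p.1 p.2).eq])
      (fun k => by
        obtain ⟨N, hN⟩ := hac k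
        refine ⟨N, fun n hn => ?_⟩
        convert (F k).neg_mem (hN n hn) using 1
        rw [hD]
        simp only [map_neg, smul_neg, sum_neg_distrib]
        abel)
      fun N => by
      have h := hF.mul_mem _ 1 _ (-a) (hx.sum_range_sub_mem hF hu N) ha'
      have h1 := (hF.mulLeft_raises hu).pow N ha'
      rw [sub_mul, sum_mul, sum_range_succ] at h
      have h2 : ∑ l ∈ range N, ((l ! : ℕ) : K)⁻¹ • ((LinearMap.mulLeft K (P (-c))) ^ l) (-a) =
          ∑ l ∈ range N, (((l ! : ℕ) : K)⁻¹ • P (-c) ^ l) * (-a) := by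
        refine sum_congr rfl fun l _ => ?_
        rw [LinearMap.pow_mulLeft, LinearMap.mulLeft_apply, smul_mul_assoc]
      rw [LinearMap.pow_mulLeft, LinearMap.mulLeft_apply] at h1
      rw [h2]
      have h3 := (F N).sub_mem (hF.antitone (by omega : N ≤ N + 1 + 1) h)
        ((F N).smul_mem ((N ! : ℕ) : K)⁻¹ (hF.antitone (by omega : N ≤ 1 + N) h1))
      convert h3 using 1
      rw [smul_mul_assoc]
      abel
  have hx2 : x = 1 - P (x * a) := by
    rw [mul_neg, map_neg, ← sub_eq_add_neg] at hx1
    exact hx1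
  rw [map_neg] at hx
  refine ⟨x, hx, hx2, fun z hz => sub_eq_zero.1 ?_⟩
  have h1 : z - x = -P ((z - x) * a) := by
    rw [sub_mul, map_sub]
    nth_rewrite 1 [hz, hx2]
    abel
  refine eq_zero_of_mem_step hF ?_ fun n hn => ?_
  · rw [h1]
    exact hF.antitone zero_le_one ((F 1).neg_mem (hP 1 _ (hF.ideal_left 1 _ _ ha)))
  · rw [h1]
    exact (F _).neg_mem (hP _ _ (hF.mul_mem n 1 _ _ hn ha))

end Filtration

/-! ### Transfer to the algebra with a unit adjoined. -/

section Unitization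

/-- The extension of an operator on `A` to `K ⊕ A` by zero on `K`. -/
noncomputable def unitizationExtend {K A : Type*} [Field K] [NonUnitalRing A] [Module K A]
    (P : A →ₗ[K] A) :
    Unitization K A →ₗ[K] Unitization K A :=
  Unitization.inrHom K K A ∘ₗ P ∘ₗ Unitization.sndHom K K A

theorem unitizationExtend_apply {K A : Type*} [Field K] [NonUnitalRing A] [Module K A]
    (P : A →ₗ[K] A) (x : Unitization K A) :
    unitizationExtend P x = (P x.snd : Unitization K A) := rfl

variable {K A : Type*} [Field K] [NonUnitalRing A] [Module K A] [IsScalarTower K A A]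
  [SMulCommClass K A A] {F : ℕ → Submodule K A}

theorem inr_mem_unitizationFiltration {n : ℕ} {x : A} :
    (x : Unitization K A) ∈ unitizationFiltration F n ↔ x ∈ F n := by
  constructor
  · rintro ⟨y, hy, h⟩
    exact Unitization.inr_injective (R := K) h ▸ hy
  · exact fun h => ⟨x, h, rfl⟩

theorem IsCompleteFiltration.unitization (hF : IsCompleteFiltration F) :
    IsCompleteFiltration (unitizationFiltration F) where
  antitone m n h := Submodule.map_mono (hF.antitone h)
  mul_mem := by
    rintro m n _ _ ⟨x, hx, rfl⟩ ⟨y, hy, rfl⟩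
    exact ⟨x * y, hF.mul_mem m n x y hx hy, by simp⟩
  ideal_left := by
    rintro n x _ ⟨y, hy, rfl⟩
    refine ⟨x.fst • y + x.snd * y,
      (F n).add_mem ((F n).smul_mem _ hy) (hF.ideal_left n _ _ hy), ?_⟩
    ext <;> simp
  ideal_right := by
    rintro n _ y ⟨x, hx, rfl⟩
    refine ⟨y.fst • x + x * y.snd,
      (F n).add_mem ((F n).smul_mem _ hx) (hF.ideal_right n _ _ hx), ?_⟩
    ext <;> simp
  complete s hs := by
    -- Differences lie in the image of `F 0`, inside `A`, so the scalar part is constant and only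
    -- the `A` part has to converge.
    have hfst : ∀ n, (s n).fst = (s 0).fst := fun n => by
      obtain ⟨x, _, hx⟩ := hs 0 n (Nat.zero_le n)
      have := congrArg (fun z : Unitization K A => z.fst) hx
      exact (sub_eq_zero.1 this.symm)
    have hsub : ∀ n (x : Unitization K A), x.fst = (s 0).fst →
        s n - x = (((s n).snd - x.snd : A) : Unitization K A) := fun n x hx => by
      ext <;> simp [sub_eq_add_neg, hfst n, hx]
    obtain ⟨l, hl, hu⟩ := hF.complete (fun n => (s n).snd) (fun m n h => by
      have := hs m n h
      rwa [hsub n (s m) (hfst m), inr_mem_unitizationFiltration] at this)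
    refine ⟨Unitization.inl (s 0).fst + (l : Unitization K A), fun n => ?_, fun y hy => ?_⟩
    · rw [hsub n _ (by simp), inr_mem_unitizationFiltration]
      simpa using hl n
    · have hyf : y.fst = (s 0).fst := by
        obtain ⟨x, _, hx⟩ := hy 0
        have := congrArg (fun z : Unitization K A => z.fst) hx
        exact (sub_eq_zero.1 this.symm).symm
      have hys : y.snd = l := hu _ fun n => by
        have := hy n
        rwa [hsub n y hyf, inr_mem_unitizationFiltration] at this
      ext <;> simp [hyf, hys]

theorem inr_ad_pow (u a : A) (n : ℕ) :
    (((ad K u ^ n) a : A) : Unitization K A) = (ad K (u : Unitization K A) ^ n) a := by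
  induction n with
  | zero => simp
  | succ n ih =>
    rw [pow_succ', pow_succ', Module.End.mul_apply, Module.End.mul_apply, ← ih]
    simp [ad]

theorem filtHasSum_inr_iff {t : ℕ → A} {l : A} :
    FiltHasSum (unitizationFiltration F) (fun n => (t n : Unitization K A)) l ↔
      FiltHasSum F t l := by
  refine forall_congr' fun k => exists_congr fun N => forall₂_congr fun n _ => ?_
  have : ((∑ i ∈ range n, t i - l : A) : Unitization K A) =
      ∑ i ∈ range n, (t i : Unitization K A) - l := by
    rw [Unitization.inr_sub]
    congr 1
    exact map_sum (Unitization.inrHom K K A) t (range n)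
  rw [← this, inr_mem_unitizationFiltration]

end Unitization

/-- Choosing the solution of the recursion pointwise. -/
theorem exists_magnus_of_existsUnique {K A : Type*} [Field K] [CharZero K] [NonUnitalRing A]
    [Module K A] [IsScalarTower K A A] [SMulCommClass K A A] {F : ℕ → Submodule K A}
    {P : A →ₗ[K] A}
    (h : ∀ a ∈ F 1, ∃! c, c ∈ F 1 ∧ FiltHasSum F
      (fun n => PowerSeries.coeff n (magnusSeries K) • ((ad K (P c)) ^ n) a) c) :
    ∃ χ : F 1 → F 1, IsZeroBCHRecursion F P χ ∧
      ∀ χ' : F 1 → F 1, IsZeroBCHRecursion F P χ' → χ' = χ := by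
  choose χ hχ hu using fun a : F 1 => h a a.2
  refine ⟨fun a => ⟨χ a, (hχ a).1⟩, fun a => (hχ a).2, fun χ' h' => ?_⟩
  funext a
  exact Subtype.ext (hu a _ ⟨(χ' a).2, h' a⟩)

end RBMagnus

/-! ### Assembly of the unital and non-unital cases. -/

theorem mainTheorem10 (K : Type u) [Field K] [CharZero K] :
    -- `A` unital
    (∀ (A : Type v) [Ring A] [Algebra K A] (F : ℕ → Submodule K A) (P : A →ₗ[K] A),
      RBMagnus.IsCompleteFilteredRotaBaxter (0 : K) F P →
      ∃ χ : F 1 → F 1, RBMagnus.IsZeroBCHRecursion F P χ ∧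
        (∀ χ' : F 1 → F 1, RBMagnus.IsZeroBCHRecursion F P χ' → χ' = χ) ∧
        ∀ a : F 1,
          (∃ x : A, RBMagnus.IsFiltExp F (-P (χ a : A)) x ∧
            x = 1 - P (x * (a : A)) ∧ ∀ z : A, z = 1 - P (z * (a : A)) → z = x) ∧
          (∃ y : A, RBMagnus.IsFiltExp F (P (χ a : A)) y ∧
            y = 1 + P ((a : A) * y) ∧ ∀ z : A, z = 1 + P ((a : A) * z) → z = y)) ∧
    -- `A` not necessarily unital: the equations live in `K ⊕ A`
    (∀ (A : Type v) [NonUnitalRing A] [Module K A] [IsScalarTower K A A] [SMulCommClass K A A]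
      (F : ℕ → Submodule K A) (P : A →ₗ[K] A),
      RBMagnus.IsCompleteFilteredRotaBaxter (0 : K) F P →
      ∃ χ : F 1 → F 1, RBMagnus.IsZeroBCHRecursion F P χ ∧
        (∀ χ' : F 1 → F 1, RBMagnus.IsZeroBCHRecursion F P χ' → χ' = χ) ∧
        ∀ a : F 1,
          (∃ x : Unitization K A,
            RBMagnus.IsFiltExp (RBMagnus.unitizationFiltration F)
              ((-P (χ a : A) : A) : Unitization K A) x ∧
            x = 1 - (P (RBMagnus.unitMul x (a : A)) : Unitization K A) ∧
            ∀ z : Unitization K A,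
              z = 1 - (P (RBMagnus.unitMul z (a : A)) : Unitization K A) → z = x) ∧
          (∃ y : Unitization K A,
            RBMagnus.IsFiltExp (RBMagnus.unitizationFiltration F)
              ((P (χ a : A) : A) : Unitization K A) y ∧
            y = 1 + (P (RBMagnus.mulUnit (a : A) y) : Unitization K A) ∧
            ∀ z : Unitization K A,
              z = 1 + (P (RBMagnus.mulUnit (a : A) z) : Unitization K A) → z = y)) := by
  refine ⟨fun A _ _ F P h => ?_, fun A _ _ _ _ F P h => ?_⟩
  · have hRB : ∀ x ∈ F 1, ∀ y ∈ F 1, P x * P y = P (x * P y) + P (P x * y) := fun x _ y _ => by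
      simpa using h.rotaBaxter x y
    obtain ⟨χ, hχ, hu⟩ := RBMagnus.exists_magnus_of_existsUnique
      (fun a ha => h.filtration.existsUnique_magnus h.map_mem ha)
    exact ⟨χ, hχ, hu, fun a =>
      ⟨RBMagnus.exists_exp_eq_one_sub h.filtration h.map_mem hRB a.2 (χ a).2 (hχ a),
        RBMagnus.exists_exp_eq_one_add h.filtration h.map_mem hRB a.2 (χ a).2 (hχ a)⟩⟩
  · have hG := h.filtration.unitization
    have hP : ∀ n x, x ∈ RBMagnus.unitizationFiltration F n →
        RBMagnus.unitizationExtend P x ∈ RBMagnus.unitizationFiltration F n := by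
      rintro n _ ⟨x, hx, rfl⟩
      exact ⟨P x, h.map_mem n x hx, rfl⟩
    -- With `x = 1` the left side is `0` and the right side is `P (P y)` for `y` in `A`, so the
    -- identity is claimed only where scalar parts vanish.
    have hRB : ∀ x ∈ RBMagnus.unitizationFiltration F 1,
        ∀ y ∈ RBMagnus.unitizationFiltration F 1,
        RBMagnus.unitizationExtend P x * RBMagnus.unitizationExtend P y =
          RBMagnus.unitizationExtend P (x * RBMagnus.unitizationExtend P y) +
          RBMagnus.unitizationExtend P (RBMagnus.unitizationExtend P x * y) := by
      rintro _ ⟨x, _, rfl⟩ _ ⟨y, _, rfl⟩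
      have := h.rotaBaxter x y
      rw [zero_smul, add_zero] at this
      simp only [RBMagnus.unitizationExtend_apply, Unitization.inrHom_apply, Unitization.snd_inr,
        ← Unitization.inr_mul, ← Unitization.inr_add, this]
    have hsum : ∀ a c : A, RBMagnus.FiltHasSum F
        (fun n => PowerSeries.coeff n (RBMagnus.magnusSeries K) •
          ((RBMagnus.ad K (P c)) ^ n) a) c ↔
        RBMagnus.FiltHasSum (RBMagnus.unitizationFiltration F)
        (fun n => PowerSeries.coeff n (RBMagnus.magnusSeries K) •
          ((RBMagnus.ad K (RBMagnus.unitizationExtend P (c : Unitization K A))) ^ n)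
            (a : Unitization K A)) (c : Unitization K A) := fun a c => by
      rw [← RBMagnus.filtHasSum_inr_iff]
      simp only [Unitization.inr_smul, RBMagnus.inr_ad_pow, RBMagnus.unitizationExtend_apply,
        Unitization.snd_inr]
    obtain ⟨χ, hχ, hu⟩ := RBMagnus.exists_magnus_of_existsUnique (F := F) (P := P) (fun a ha => by
      obtain ⟨_, ⟨⟨c, hc, rfl⟩, hc2⟩, hu⟩ := hG.existsUnique_magnus hP
        (RBMagnus.inr_mem_unitizationFiltration.2 ha)
      refine ⟨c, ⟨hc, (hsum a c).2 hc2⟩, fun d hd => Unitization.inr_injective (R := K) ?_⟩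
      exact hu d ⟨RBMagnus.inr_mem_unitizationFiltration.2 hd.1, (hsum a d).1 hd.2⟩)
    refine ⟨χ, hχ, hu, fun a => ?_⟩
    have ha := RBMagnus.inr_mem_unitizationFiltration (K := K).2 a.2
    have hc := RBMagnus.inr_mem_unitizationFiltration (K := K).2 (χ a).2
    have hx := RBMagnus.exists_exp_eq_one_sub hG hP hRB ha hc ((hsum a (χ a)).1 (hχ a))
    have hy := RBMagnus.exists_exp_eq_one_add hG hP hRB ha hc ((hsum a (χ a)).1 (hχ a))
    rw [RBMagnus.unitizationExtend_apply, Unitization.snd_inr] at hx hy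
    rw [← Unitization.inr_neg] at hx
    exact ⟨hx, hy⟩
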